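/- Let $(M^n,g)$ be a complete Hermitian manifold, that is, a complex manifold of complex dimension $n$ with complex structure $J$ and a smooth Riemannian metric $g=\langle\cdot,\cdot\rangle$ such that $g(Ju,Jv)=g(u,v)$, complete as a Riemannian manifold. Let $\nabla^b$ be its Bismut connection, i.e. the unique connection on $TM$ with $\nabla^b g=0$, $\nabla^b J=0$ and totally skew-symmetric torsion. Let $T^b$ be its torsion and $R^b(x,y,z,w)=\langle \nabla^b_x\nabla^b_y z-\nabla^b_y\nabla^b_x z-\nabla^b_{[x,y]}z,\,w\rangle$ its curvature, with $\langle\cdot,\cdot\rangle$ and $R^b$ extended complex multilinearly to $TM\otimes\mathbb{C}$. Assume that 1. $(M,g)$ is Bismut Ambrose-Singer (BAS): $\nabla^b T^b=0$ and $\nabla^b R^b=0$; 2. $g$ is Bismut Kähler-like: $R^b(x,y,z,\overline{w})=0$ and $R^b(x,\overline{y},z,\overline{w})=R^b(z,\overline{y},x,\overline{w})$ for all tangent vectors $x,y,z,w$ of type $(1,0)$; 3. the first Bismut Ricci curvature vanishes: $\mathrm{Ric}^{b(1)}(x,y)=\sum_{i=1}^n R^b(x,y,e_i,\overline{e}_i)=0$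 for all $x,y\in TM\otimes\mathbb{C}$, where $e_1,\dots,e_n$ is a unitary frame of type $(1,0)$ vectors, $\langle e_i,\overline{e}_j\rangle=\delta_{ij}$. Then $g$ is Bismut flat: $R^b=0$. -/

import Mathlib

open Bundle
open scoped Manifold ContDiff Bundle

noncomputable section

namespace HermitianGeometry

/-! ### Complex manifolds as real manifolds

Throughout, `E` is a finite-dimensional complex normed space and `M` is a complex manifold modelled
on `E`, that is, `M` has an `E`-valued atlas with holomorphic transition maps. -/

/-- A complex manifold is, with the same atlas, a smooth real manifold. -/
instance isManifold_real_of_complex (E : Type*) [NormedAddCommGroup E] [NormedSpace ℂ E]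
    (M : Type*) [TopologicalSpace M] [ChartedSpace E M] [h : IsManifold 𝓘(ℂ, E) ω M] :
    IsManifold 𝓘(ℝ, E) ∞ M := by
  refine isManifold_of_contDiffOn _ _ _ fun e e' he he' => ?_
  have h1 := h.compatible he he'
  rw [contDiffGroupoid, mem_groupoid_of_pregroupoid] at h1
  have h2 : ContDiffOn ℂ ω (𝓘(ℂ, E) ∘ (e.symm ≫ₕ e') ∘ 𝓘(ℂ, E).symm)
      (𝓘(ℂ, E).symm ⁻¹' (e.symm ≫ₕ e').source ∩ Set.range 𝓘(ℂ, E)) := h1.1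
  exact (h2.restrict_scalars ℝ).of_le le_top

section Defs

variable {E : Type*} [NormedAddCommGroup E] [NormedSpace ℂ E]
  {M : Type*} [TopologicalSpace M] [ChartedSpace E M]

/-- The complex structure `J` on the real tangent space `T_x M`: multiplication by `i` in
holomorphic coordinates. (`TangentSpace` is the model space `E`, read through the preferred
holomorphic chart at `x`; any other holomorphic chart gives the same `J`, because the differentials
of the transition maps are complex linear.) -/
def tangentJ (x : M) : TangentSpace 𝓘(ℝ, E) x →L[ℝ] TangentSpace 𝓘(ℝ, E) x :=
  (Complex.I • ContinuousLinearMap.id ℝ E : E →L[ℝ] E)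

/-- A smooth (real) vector field on `M`. -/
def IsSmoothField [IsManifold 𝓘(ℂ, E) ω M] (X : Π x : M, TangentSpace 𝓘(ℝ, E) x) : Prop :=
  ContMDiff 𝓘(ℝ, E) 𝓘(ℝ, E).tangent ∞ (fun x => (⟨x, X x⟩ : TangentBundle 𝓘(ℝ, E) M))

/-- An affine connection on `M` (a covariant derivative on the real tangent bundle).
Beware of the order of the arguments: `D Y x (X x)` is `(D_X Y)(x)`. -/
abbrev Connection (E : Type*) [NormedAddCommGroup E] [NormedSpace ℂ E]
    (M : Type*) [TopologicalSpace M] [ChartedSpace E M] [IsManifold 𝓘(ℂ, E) ω M] : Type _ :=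
  CovariantDerivative 𝓘(ℝ, E) E (fun x : M => TangentSpace 𝓘(ℝ, E) x)

end Defs

/-! ### Torsion and curvature of a connection, and their covariant derivatives -/

section Curvature

variable {E : Type*} [NormedAddCommGroup E] [NormedSpace ℂ E]
  {M : Type*} [TopologicalSpace M] [ChartedSpace E M] [IsManifold 𝓘(ℂ, E) ω M]

/-- The vector field `R(X, Y) Z = D_X D_Y Z - D_Y D_X Z - D_{[X, Y]} Z`, for vector fields
`X`, `Y`, `Z`. -/
def curvatureField (D : Connection E M) (X Y Z : Π x : M, TangentSpace 𝓘(ℝ, E) x) (x : M) :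
    TangentSpace 𝓘(ℝ, E) x :=
  D (fun y => D Z y (Y y)) x (X x) - D (fun y => D Z y (X y)) x (Y x)
    - D Z x (VectorField.mlieBracket 𝓘(ℝ, E) X Y x)

/-- The curvature tensor `R(u, v) w` of a connection, for tangent vectors `u`, `v`, `w` at `x`.
The value at `x` of the field `R(X, Y) Z` only depends on the values of the smooth fields `X`, `Y`,
`Z` at `x`; here they are taken to be the fields with constant components `u`, `v`, `w` in the
preferred chart at `x`. -/
def curvature (D : Connection E M) (x : M) (u v w : TangentSpace 𝓘(ℝ, E) x) :
    TangentSpace 𝓘(ℝ, E) x :=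
  curvatureField D (FiberBundle.extend E u) (FiberBundle.extend E v) (FiberBundle.extend E w) x

/-- The connection `D` is flat: its curvature vanishes identically. -/
def IsFlat (D : Connection E M) : Prop :=
  ∀ (x : M) (u v w : TangentSpace 𝓘(ℝ, E) x), curvature D x u v w = 0

/-- The curvature is parallel, `D R = 0`: for all smooth vector fields,
`(D_V R)(X, Y) Z = D_V (R(X, Y) Z) - R(D_V X, Y) Z - R(X, D_V Y) Z - R(X, Y) (D_V Z)` vanishes. -/
def ParallelCurvature (D : Connection E M) : Prop :=
  ∀ V X Y Z : Π x : M, TangentSpace 𝓘(ℝ, E) x,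
    IsSmoothField V → IsSmoothField X → IsSmoothField Y → IsSmoothField Z → ∀ x : M,
      D (fun y => curvature D y (X y) (Y y) (Z y)) x (V x)
        - curvature D x (D X x (V x)) (Y x) (Z x)
        - curvature D x (X x) (D Y x (V x)) (Z x)
        - curvature D x (X x) (Y x) (D Z x (V x)) = 0

variable [FiniteDimensional ℂ E]

/-- The torsion `T(X, Y) = D_X Y - D_Y X - [X, Y]` is parallel, `D T = 0`: for all smooth vector
fields, `(D_V T)(X, Y) = D_V (T(X, Y)) - T(D_V X, Y) - T(X, D_V Y)` vanishes. -/
def ParallelTorsion (D : Connection E M) : Prop :=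
  ∀ V X Y : Π x : M, TangentSpace 𝓘(ℝ, E) x,
    IsSmoothField V → IsSmoothField X → IsSmoothField Y → ∀ x : M,
      D (fun y => D.torsion y (X y) (Y y)) x (V x)
        - D.torsion x (D X x (V x)) (Y x)
        - D.torsion x (X x) (D Y x (V x)) = 0

/-- An Ambrose-Singer connection: torsion and curvature are parallel with respect to the connection
itself. -/
def IsAmbroseSinger (D : Connection E M) : Prop :=
  ParallelTorsion D ∧ ParallelCurvature D

end Curvature

/-! ### Complexified tangent vectors -/

section Complexified

variable {E : Type*} [NormedAddCommGroup E] [NormedSpace ℂ E]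
  {M : Type*} [TopologicalSpace M] [ChartedSpace E M]

/-- The complexified tangent space `T_x M ⊗ ℂ`; the pair `(u, v)` stands for `u + i v`. -/
abbrev ComplexTangent (E : Type*) [NormedAddCommGroup E] [NormedSpace ℂ E]
    {M : Type*} [TopologicalSpace M] [ChartedSpace E M] (x : M) : Type _ :=
  TangentSpace 𝓘(ℝ, E) x × TangentSpace 𝓘(ℝ, E) x

/-- Complex conjugation, `u + i v ↦ u - i v`. -/
def conjT {x : M} (a : ComplexTangent E x) : ComplexTangent E x := (a.1, -a.2)

/-- The complexified vector `a` has type `(1, 0)`: `J a = i a` for the complex linear extension of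
`J`, where `i (u + i v) = -v + i u`. -/
def IsType10 {x : M} (a : ComplexTangent E x) : Prop :=
  tangentJ x a.1 = -a.2 ∧ tangentJ x a.2 = a.1

/-- The complex linear extension of a real linear map `f` to `ℂ`, at `a = u + i v`. -/
def extendC {x : M} (f : TangentSpace 𝓘(ℝ, E) x → ℂ) (a : ComplexTangent E x) : ℂ :=
  f a.1 + Complex.I * f a.2

variable [RiemannianBundle (fun x : M => TangentSpace 𝓘(ℝ, E) x)]

/-- The complex bilinear extension of the Riemannian metric to complexified tangent vectors. -/
def complexMetric {x : M} (a b : ComplexTangent E x) : ℂ :=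
  extendC (fun u => extendC (fun v => ((inner ℝ u v : ℝ) : ℂ)) b) a

/-- A unitary frame of type `(1, 0)` at `x`: vectors `e_1, …, e_n` of type `(1, 0)`, `n` the complex
dimension, with `⟨e_i, conj e_j⟩ = δ_ij`. -/
def IsUnitaryFrame {x : M} (e : Fin (Module.finrank ℂ E) → ComplexTangent E x) : Prop :=
  (∀ i, IsType10 (e i)) ∧ ∀ i j, complexMetric (e i) (conjT (e j)) = if i = j then 1 else 0

end Complexified

/-! ### Hermitian metrics and the Bismut connection -/

section Hermitian

variable {E : Type*} [NormedAddCommGroup E] [NormedSpace ℂ E] [FiniteDimensional ℂ E]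
  {M : Type*} [TopologicalSpace M] [ChartedSpace E M] [IsManifold 𝓘(ℂ, E) ω M]
  [RiemannianBundle (fun x : M => TangentSpace 𝓘(ℝ, E) x)]

/-- The Riemannian metric of `M` is Hermitian: `g(J u, J v) = g(u, v)`. -/
def IsHermitianMetric (E : Type*) [NormedAddCommGroup E] [NormedSpace ℂ E]
    (M : Type*) [TopologicalSpace M] [ChartedSpace E M]
    [RiemannianBundle (fun x : M => TangentSpace 𝓘(ℝ, E) x)] : Prop :=
  ∀ (x : M) (u v : TangentSpace 𝓘(ℝ, E) x),
    inner ℝ (tangentJ x u) (tangentJ x v) = (inner ℝ u v : ℝ)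

/-- `D` is the Bismut connection of the Hermitian metric: the (unique) smooth connection on the
tangent bundle with `D g = 0`, `D J = 0` and totally skew-symmetric torsion. (The torsion `T(u, v)`
of any connection is skew-symmetric in `u`, `v`; the last field adds that `⟨T(u, v), w⟩` is
skew-symmetric in `v`, `w`.) -/
structure IsBismutConnection (D : Connection E M) : Prop where
  smooth : D.ContMDiffCovariantDerivative ∞
  metric : ∀ X Y : Π x : M, TangentSpace 𝓘(ℝ, E) x, IsSmoothField X → IsSmoothField Y →
    ∀ (x : M) (v : TangentSpace 𝓘(ℝ, E) x),
      mvfderiv 𝓘(ℝ, E) (fun y => (inner ℝ (X y) (Y y) : ℝ)) x v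
        = inner ℝ (D X x v) (Y x) + inner ℝ (X x) (D Y x v)
  complex : ∀ X : Π x : M, TangentSpace 𝓘(ℝ, E) x, IsSmoothField X →
    ∀ (x : M) (v : TangentSpace 𝓘(ℝ, E) x),
      D (fun y => tangentJ y (X y)) x v = tangentJ x (D X x v)
  skew : ∀ (x : M) (u v w : TangentSpace 𝓘(ℝ, E) x),
    (inner ℝ (D.torsion x u v) w : ℝ) = -inner ℝ (D.torsion x u w) v

/-- The curvature as a covariant 4-tensor `R(a, b, c, d) = ⟨R(a, b) c, d⟩`, extended complex
linearly in each argument to complexified tangent vectors. -/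
def curvatureC (D : Connection E M) {x : M} (a b c d : ComplexTangent E x) : ℂ :=
  extendC (fun u => extendC (fun v => extendC (fun w => extendC (fun z =>
    ((inner ℝ (curvature D x u v w) z : ℝ) : ℂ)) d) c) b) a

/-- The curvature of `D` is Kähler-like: it has all the symmetries of the curvature of a Kähler
metric, `R(X, Y, Z, conj W) = 0` and `R(X, conj Y, Z, conj W) = R(Z, conj Y, X, conj W)` for all
`X`, `Y`, `Z`, `W` of type `(1, 0)`. -/
def IsKahlerLike (D : Connection E M) : Prop :=
  ∀ (x : M) (X Y Z W : ComplexTangent E x),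
    IsType10 X → IsType10 Y → IsType10 Z → IsType10 W →
      curvatureC D X Y Z (conjT W) = 0 ∧
      curvatureC D X (conjT Y) Z (conjT W) = curvatureC D Z (conjT Y) X (conjT W)

/-- The first Ricci curvature `Ric⁽¹⁾(a, b) = ∑ i, R(a, b, e_i, conj e_i)`, computed in the unitary
frame `e`. -/
def firstRicci (D : Connection E M) {x : M}
    (e : Fin (Module.finrank ℂ E) → ComplexTangent E x) (a b : ComplexTangent E x) : ℂ :=
  ∑ i, curvatureC D a b (e i) (conjT (e i))

/-- The first Ricci curvature of `D` vanishes identically (in all unitary frames). -/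
def FirstRicciVanishes (D : Connection E M) : Prop :=
  ∀ (x : M) (e : Fin (Module.finrank ℂ E) → ComplexTangent E x), IsUnitaryFrame e →
    ∀ a b : ComplexTangent E x, firstRicci D e a b = 0

end Hermitian

end HermitianGeometry

end

/-! ### Orthonormal bases and skew endomorphisms for abstract inner products -/

section LinearAlgebra

open Module

/-! At each point the statement becomes algebra. Since the curvature is parallel, the Ricci identity
makes every `R x y` act on `R` as a derivation (`curvature_curvature`). The Kähler-like identities
give J-invariance, the first Bianchi identity and pair symmetry (`kahlerLike_invariant`,
`kahlerLike_bianchi_and_pair_symm`). With these, the vanishing of the first Ricci curvature, which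
says that `J ∘ R x y` has trace zero, forces the ordinary Ricci tensor to vanish
(`ricci_eq_zero_of_trace_comp`).

It remains to see that a Ricci-flat curvature tensor annihilated by its own endomorphisms is zero
(`curvatureTensor_eq_zero`), as for Ricci-flat symmetric spaces. Let 𝔨 be the Lie algebra of skew
endomorphisms annihilating `R`, and h = R(x, y) ∈ 𝔨. For B ∈ 𝔨, [h, B] = R(By, x) - R(Bx, y). Insert
this for one factor of tr(ad h ∘ ad h) and move the trace to V: Ricci-flatness kills half of the
terms and Bianchi turns the rest into -tr(h²). Now ad h is skew for minus the trace form on 𝔨, so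
tr(ad h ∘ ad h) ≤ 0 and tr(h²) ≥ 0. But h is skew, so tr(h²) = -∑|h eᵢ|² and h = 0. -/

/-- A positive definite Hermitian form on a finite-dimensional space has an orthonormal basis. -/
theorem InnerProductSpace.Core.exists_orthonormal_basis {𝕜 V : Type*} [RCLike 𝕜] [AddCommGroup V]
    [Module 𝕜 V] [FiniteDimensional 𝕜 V] (c : InnerProductSpace.Core 𝕜 V) :
    ∃ b : Basis (Fin (finrank 𝕜 V)) 𝕜 V,
      (∀ i j, c.inner (b i) (b j) = if i = j then 1 else 0) ∧
        ∀ i v, b.repr v i = c.inner (b i) v := by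
  let _ : NormedAddCommGroup V := c.toNormedAddCommGroup
  let _ : InnerProductSpace 𝕜 V := InnerProductSpace.ofCore c.toCore
  let b := stdOrthonormalBasis 𝕜 V
  exact ⟨b.toBasis, fun i j => by simpa using orthonormal_iff_ite.1 b.orthonormal i j,
    fun i v => by simpa using b.repr_apply_apply v i⟩

/-- The square of an endomorphism that is skew-adjoint for a positive definite symmetric form has
nonpositive trace. -/
theorem trace_comp_self_nonpos_of_skew {V : Type*} [AddCommGroup V] [Module ℝ V]
    [FiniteDimensional ℝ V] (c : InnerProductSpace.Core ℝ V) (S : End ℝ V)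
    (hS : ∀ x y, c.inner (S x) y = -c.inner x (S y)) :
    LinearMap.trace ℝ V (S ∘ₗ S) ≤ 0 := by
  obtain ⟨b, -, hb⟩ := c.exists_orthonormal_basis
  rw [LinearMap.trace_eq_matrix_trace ℝ b, Matrix.trace]
  refine Finset.sum_nonpos fun i _ => ?_
  have h1 := hS (b i) (S (b i))
  have h2 := c.re_inner_nonneg (S (b i))
  simp only [Matrix.diag_apply, LinearMap.toMatrix_apply, hb, LinearMap.comp_apply]
  simp only [RCLike.re_to_real] at h2
  linarith

end LinearAlgebra

/-! ### Ricci-flat curvature tensors annihilated by their own endomorphisms -/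

section CurvatureTensor

open Module

attribute [local instance] LieRing.ofAssociativeRing

variable {V : Type*} [NormedAddCommGroup V] [InnerProductSpace ℝ V] [FiniteDimensional ℝ V]

/-- The diagonal entries of A² are -|A eᵢ|². This gives both the positivity of minus the trace form
on the stabilizer and the conclusion h = 0 at the end. -/
theorem trace_comp_self_of_skew {A : End ℝ V} (hA : ∀ x y, (inner ℝ (A x) y : ℝ) = -inner ℝ x (A y)) :
    LinearMap.trace ℝ V (A ∘ₗ A)
      = -∑ i, ‖A (stdOrthonormalBasis ℝ V i)‖ ^ 2 := by
  rw [LinearMap.trace_eq_sum_inner _ (stdOrthonormalBasis ℝ V), ← Finset.sum_neg_distrib]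
  refine Finset.sum_congr rfl fun i _ => ?_
  rw [← real_inner_self_eq_norm_sq, hA]
  simp

theorem eq_zero_of_skew_of_trace_nonneg {A : End ℝ V}
    (hA : ∀ x y, (inner ℝ (A x) y : ℝ) = -inner ℝ x (A y))
    (h : 0 ≤ LinearMap.trace ℝ V (A ∘ₗ A)) : A = 0 := by
  rw [trace_comp_self_of_skew hA] at h
  have h0 : ∑ i, ‖A (stdOrthonormalBasis ℝ V i)‖ ^ 2 = 0 :=
    le_antisymm (by linarith) (Finset.sum_nonneg fun i _ => by positivity)
  rw [Finset.sum_eq_zero_iff_of_nonneg fun i _ => by positivity] at h0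
  refine (stdOrthonormalBasis ℝ V).toBasis.ext fun i => ?_
  simpa using h0 i (Finset.mem_univ i)

/-- The skew-adjoint endomorphisms that annihilate the curvature tensor `R` form a Lie algebra. -/
def curvatureStabilizer (R : V →ₗ[ℝ] V →ₗ[ℝ] End ℝ V) : LieSubalgebra ℝ (End ℝ V) where
  carrier := {A | (∀ x y, (inner ℝ (A x) y : ℝ) = -inner ℝ x (A y)) ∧
    ∀ x y z, A (R x y z) = R (A x) y z + R x (A y) z + R x y (A z)}
  add_mem' := by
    rintro A B ⟨hA, hA'⟩ ⟨hB, hB'⟩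
    refine ⟨fun x y => ?_, fun x y z => ?_⟩
    · simp only [LinearMap.add_apply, inner_add_left, inner_add_right, hA, hB]; ring
    · simp only [LinearMap.add_apply, map_add, hA', hB']; abel
  zero_mem' := by simp
  smul_mem' := by
    rintro c A ⟨hA, hA'⟩
    refine ⟨fun x y => ?_, fun x y z => ?_⟩
    · simp only [LinearMap.smul_apply, real_inner_smul_left, real_inner_smul_right, hA]; ring
    · simp only [LinearMap.smul_apply, map_smul, hA', smul_add]
  lie_mem' := by
    rintro A B ⟨hA, hA'⟩ ⟨hB, hB'⟩
    refine ⟨fun x y => ?_, fun x y z => ?_⟩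
    · simp only [LieRing.of_associative_ring_bracket, LinearMap.sub_apply, Module.End.mul_apply, inner_sub_left, inner_sub_right, hA, hB]; ring
    · simp only [LieRing.of_associative_ring_bracket, LinearMap.sub_apply, Module.End.mul_apply, map_sub, map_add, hA', hB']
      abel

variable {R : V →ₗ[ℝ] V →ₗ[ℝ] End ℝ V}

/-- Minus the trace form, as an inner product on the stabilizer of `R`. -/
@[reducible]
noncomputable def curvatureStabilizerCore (R : V →ₗ[ℝ] V →ₗ[ℝ] End ℝ V) :
    InnerProductSpace.Core ℝ (curvatureStabilizer R) where
  inner A B := -LinearMap.trace ℝ V (A.1 ∘ₗ B.1)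
  conj_inner_symm A B := by
    simp [LinearMap.trace_comp_comm' A.1 B.1]
  re_inner_nonneg A := by
    have := trace_comp_self_of_skew A.2.1
    have h : 0 ≤ ∑ i, ‖A.1 (stdOrthonormalBasis ℝ V i)‖ ^ 2 :=
      Finset.sum_nonneg fun i _ => by positivity
    simp only [RCLike.re_to_real]
    linarith
  add_left A B C := by simp [LinearMap.add_comp]; ring
  smul_left A B r := by simp [LinearMap.smul_comp]
  definite A h := by
    have := eq_zero_of_skew_of_trace_nonneg A.2.1 (by linarith)
    exact Subtype.ext this

/-- By cyclicity of the trace, minus the trace form is ad-invariant, so `ad A` is skew for it. -/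
theorem trace_ad_comp_ad_nonpos (A : curvatureStabilizer R) :
    LinearMap.trace ℝ _ (LieAlgebra.ad ℝ (curvatureStabilizer R) A ∘ₗ
      LieAlgebra.ad ℝ (curvatureStabilizer R) A) ≤ 0 := by
  refine trace_comp_self_nonpos_of_skew (curvatureStabilizerCore R) _ fun B C => ?_
  change -LinearMap.trace ℝ V ((A.1 * B.1 - B.1 * A.1) * C.1)
    = - -LinearMap.trace ℝ V (B.1 * (A.1 * C.1 - C.1 * A.1))
  have h := LinearMap.trace_mul_comm ℝ A.1 (B.1 * C.1)
  simp only [sub_mul, mul_sub, map_sub, ← mul_assoc] at h ⊢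
  linarith

/-- A Ricci-flat algebraic curvature tensor that is annihilated by its own curvature
endomorphisms vanishes. -/
theorem curvatureTensor_eq_zero
    (skew₁ : ∀ x y, R x y = -R y x)
    (skew₂ : ∀ x y z w, (inner ℝ (R x y z) w : ℝ) = -inner ℝ z (R x y w))
    (bianchi : ∀ x y z, R x y z + R y z x + R z x y = 0)
    (invariant : ∀ u v x y z,
      R u v (R x y z) = R (R u v x) y z + R x (R u v y) z + R x y (R u v z))
    (ricci : ∀ x y, LinearMap.trace ℝ V ((R.flip y).flip x) = 0) (x y : V) : R x y = 0 := by
  -- `ρ y` sends v to R(v, y), which lies in the stabilizer by `skew₂` and `invariant`; `α x` is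
  -- evaluation at x.
  let ρ (y : V) : V →ₗ[ℝ] curvatureStabilizer R :=
    (R.flip y).codRestrict (curvatureStabilizer R).toSubmodule
      fun v => ⟨skew₂ v y, invariant v y⟩
  let α (x : V) : curvatureStabilizer R →ₗ[ℝ] V :=
    (LinearMap.applyₗ x) ∘ₗ (curvatureStabilizer R).toSubmodule.subtype
  have : Module.Free ℝ (curvatureStabilizer R) := Module.Free.of_divisionRing _ _
  have : Module.Finite ℝ (curvatureStabilizer R) :=
    inferInstanceAs (Module.Finite ℝ (curvatureStabilizer R).toSubmodule)
  let h : curvatureStabilizer R := ρ y x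
  have had : LieAlgebra.ad ℝ (curvatureStabilizer R) h = ρ x ∘ₗ α y - ρ y ∘ₗ α x := by
    ext B z
    change R x y (B.1 z) - B.1 (R x y z) = R (B.1 y) x z - R (B.1 x) y z
    rw [B.2.2, skew₁ (B.1 y) x]
    simp only [LinearMap.neg_apply]
    abel
  -- Cyclicity moves the trace to V, where the map is v ↦ [R(x, y), R(v, a)] b. The term R(v, a)
  -- (R(x, y) b) has a Ricci curvature as trace and drops out.
  have htr (a b : V) : LinearMap.trace ℝ _ (ρ a ∘ₗ α b ∘ₗ LieAlgebra.ad ℝ (curvatureStabilizer R) h)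
      = LinearMap.trace ℝ V (R x y ∘ₗ (R.flip a).flip b) := by
    rw [LinearMap.trace_comp_comm', LinearMap.comp_assoc]
    have : α b ∘ₗ LieAlgebra.ad ℝ (curvatureStabilizer R) h ∘ₗ ρ a
        = R x y ∘ₗ (R.flip a).flip b - (R.flip a).flip (R x y b) := by
      ext v
      rfl
    rw [this, map_sub, ricci, sub_zero]
  have hkey := trace_ad_comp_ad_nonpos h
  nth_rewrite 1 [had] at hkey
  rw [LinearMap.sub_comp, LinearMap.comp_assoc _ (α y), LinearMap.comp_assoc _ (α x), map_sub,
    htr, htr, ← map_sub,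
    ← LinearMap.comp_sub] at hkey
  have hB : (R.flip x).flip y - (R.flip y).flip x = -R x y := by
    ext v
    have := bianchi v y x
    rw [skew₁ y x, skew₁ x v] at this
    simp only [LinearMap.sub_apply, LinearMap.flip_apply, LinearMap.neg_apply] at this ⊢
    rw [← sub_eq_zero, ← neg_eq_zero, ← this]
    abel
  rw [hB, LinearMap.comp_neg, map_neg] at hkey
  exact eq_zero_of_skew_of_trace_nonneg (skew₂ x y) (by linarith)

end CurvatureTensor

/-! ### Symmetries of Kähler-like curvature tensors -/

section KahlerLike

/-- A quadrilinear form with the symmetries of the curvature tensor of a Hermitian connection which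
vanishes on `(1, 0)`-vectors in the first two slots is `J`-invariant in these slots. The hypothesis
`h` is the real part of `r(X, Y, Z, conj W) = 0`. -/
theorem kahlerLike_invariant {V : Type*} {J : V → V} {r : V → V → V → V → ℝ}
    (skew₂ : ∀ x y z w, r x y z w = -r x y w z)
    (inv₂ : ∀ x y z w, r x y (J z) w = -r x y z (J w))
    (inv₂' : ∀ x y z w, r x y (J z) (J w) = r x y z w)
    (h : ∀ x y z w, r x y z w - r (J x) (J y) z w - r (J x) y (J z) w + r (J x) y z (J w)
      - r x (J y) (J z) w + r x (J y) z (J w) + r x y (J z) (J w)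
      - r (J x) (J y) (J z) (J w) = 0) (x y z w : V) :
    r (J x) (J y) z w = r x y z w := by
  -- In `h` the terms with a single J in each pair of slots are symmetric in z, w, while r(x, y, z,
  -- w) - r(Jx, Jy, z, w) is skew; subtracting the swapped identity isolates the latter.
  have h1 := h x y z w
  have h2 := h x y w z
  simp only [inv₂'] at h1 h2
  simp only [inv₂] at h1 h2
  have h3 := inv₂ (J x) y z w
  have h4 := inv₂ x (J y) z w
  rw [skew₂] at h3 h4
  linarith [skew₂ x y z w, skew₂ (J x) (J y) z w]

section

variable {V : Type*} {J : V → V} {r : V → V → V → V → ℝ}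
    (skew₁ : ∀ x y z w, r x y z w = -r y x z w)
    (skew₂ : ∀ x y z w, r x y z w = -r x y w z)
    (sq₁ : ∀ x y z w, r (J (J x)) y z w = -r x y z w)
    (inv₁ : ∀ x y z w, r (J x) (J y) z w = r x y z w)
    (inv₂ : ∀ x y z w, r x y (J z) w = -r x y z (J w))
    (inv₂' : ∀ x y z w, r x y (J z) (J w) = r x y z w)
    (h : ∀ x y z w, r x y z w + r (J x) (J y) z w - r (J x) y (J z) w + r (J x) y z (J w)
      + r x (J y) (J z) w - r x (J y) z (J w) + r x y (J z) (J w) + r (J x) (J y) (J z) (J w)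
      = r z y x w + r (J z) (J y) x w - r (J z) y (J x) w + r (J z) y x (J w)
      + r z (J y) (J x) w - r z (J y) x (J w) + r z y (J x) (J w) + r (J z) (J y) (J x) (J w))
include skew₁ skew₂ sq₁ inv₁ inv₂ inv₂' h

/-- Kähler-like curvature tensors satisfy the first Bianchi identity and are symmetric under
exchange of the first and the last two slots. The hypothesis `h` is the real part of
`r(X, conj Y, Z, conj W) = r(Z, conj Y, X, conj W)`. -/
theorem kahlerLike_bianchi_and_pair_symm (x y z w : V) :
    r x y z w + r y z x w + r z x y w = 0 ∧ r x y z w = r z w x y := by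
  have inv₁' (x y z w : V) : r x (J y) z w = -r (J x) y z w := by
    rw [← inv₁ x (J y), inv₁, ← neg_neg (r x (J y) z w), ← sq₁, inv₁]
  -- Each side of `h` is 4 `H`, so `H` is a quarter of the real part of r(X, conj Y, Z, conj W). It
  -- determines r by `hrH`, and has all symmetries preserving the pairing of slots {1, 3}, {2, 4},
  -- which makes both claims cancellations.
  let H (x y z w : V) : ℝ := r x y z w + r (J x) y z (J w)
  have hrH (x y z w : V) : 2 * r x y z w = H x y z w - H x y w z := by
    have h3 := inv₂ (J x) y z w
    rw [skew₂] at h3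
    simp only [H]
    linarith [skew₂ x y z w]
  have h13 (x y z w : V) : H x y z w = H z y x w := by
    have h1 := h x y z w
    simp only [inv₂', inv₁, inv₁'] at h1
    simp only [inv₂] at h1
    simp only [H]
    linarith
  have hsw (x y z w : V) : H x y z w = H y x w z := by
    simp only [H]
    rw [skew₁ y x, skew₂ x y w z, skew₁ (J y), inv₁', skew₂ (J x) y w (J z), inv₂]
    ring
  have h24 (x y z w : V) : H x y z w = H x w z y := by
    rw [hsw, h13, hsw]
  have hcyc (x y z w : V) : H x y z w = H y z w x := (hsw x y z w).trans (h24 y x w z)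
  constructor
  · linarith [hrH x y z w, hrH y z x w, hrH z x y w, hcyc x y z w, hcyc z x y w, hcyc y z x w]
  · linarith [hrH x y z w, hrH z w x y, hcyc x y z w, hcyc y z w x, hcyc x y w z, h13 y w z x]

end

end KahlerLike

/-! ### Ricci traces and unitary frames -/

section Traces

open Module

variable {V : Type*} [NormedAddCommGroup V] [InnerProductSpace ℝ V] [FiniteDimensional ℝ V]

/-- The real trace of `J A`, for `A` commuting with `J`, in a unitary frame. -/
theorem trace_comp_of_unitary {J A : End ℝ V} (hJ : ∀ x, J (J x) = -x)
    (hJi : ∀ x y, (inner ℝ (J x) (J y) : ℝ) = inner ℝ x y) (hA : ∀ x, A (J x) = J (A x))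
    {n : ℕ} (hn : finrank ℝ V = 2 * n) {u : Fin n → V}
    (hu : ∀ i j, (inner ℝ (u i) (u j) : ℝ) = if i = j then 1 else 0)
    (hu' : ∀ i j, (inner ℝ (u i) (J (u j)) : ℝ) = 0) :
    LinearMap.trace ℝ V (J ∘ₗ A) = -2 * ∑ i, (inner ℝ (A (u i)) (J (u i)) : ℝ) := by
  let c : Fin n ⊕ Fin n → V := Sum.elim u (J ∘ u)
  have hc : Orthonormal ℝ c := by
    rw [orthonormal_iff_ite]
    rintro (i | i) (j | j) <;> simp [c, hu, hu', hJi, real_inner_comm]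
  have hcard : Fintype.card (Fin n ⊕ Fin n) = finrank ℝ V := by
    simp [hn, two_mul]
  -- The basis built from an orthonormal family needs a nonempty index type, so dimension zero is
  -- separate.
  rcases isEmpty_or_nonempty (Fin n) with h | h
  · have : Subsingleton V := by
      rw [← finrank_zero_iff (R := ℝ), ← hcard]
      simp
    have h0 : J ∘ₗ A = 0 := LinearMap.ext fun x => Subsingleton.elim _ _
    simp [h0]
  let b := (basisOfOrthonormalOfCardEqFinrank hc hcard).toOrthonormalBasis (by simpa using hc)
  have hb (k) : b k = c k := by simp [b]
  rw [LinearMap.trace_eq_sum_inner _ b, Fintype.sum_sum_type, Finset.mul_sum,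
    ← Finset.sum_add_distrib]
  refine Finset.sum_congr rfl fun i _ => ?_
  have h1 : (inner ℝ (u i) (J (A (u i))) : ℝ) = -inner ℝ (A (u i)) (J (u i)) := by
    rw [← hJi, hJ, inner_neg_right, real_inner_comm]
  simp only [hb, c, Sum.elim_inl, Sum.elim_inr, Function.comp, LinearMap.comp_apply, hA, hJ,
    inner_neg_right, h1]
  rw [real_inner_comm]
  ring

/-- For a curvature tensor with the symmetries of a Kähler curvature tensor, the Ricci tensor is
determined by the traces of `J R(x, y)`. -/
theorem ricci_eq_zero_of_trace_comp {J : End ℝ V} {R : V →ₗ[ℝ] V →ₗ[ℝ] End ℝ V}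
    (hJ : ∀ x, J (J x) = -x)
    (skew₁ : ∀ x y, R x y = -R y x)
    (skew₂ : ∀ x y z w, (inner ℝ (R x y z) w : ℝ) = -inner ℝ z (R x y w))
    (inv₁ : ∀ x y, R (J x) (J y) = R x y)
    (comm : ∀ x y z, R x y (J z) = J (R x y z))
    (bianchi : ∀ x y z, R x y z + R y z x + R z x y = 0)
    (pair : ∀ x y z w, (inner ℝ (R x y z) w : ℝ) = inner ℝ (R z w x) y)
    (htr : ∀ x y, LinearMap.trace ℝ V (J ∘ₗ R x y) = 0) (x y : V) :
    LinearMap.trace ℝ V ((R.flip y).flip x) = 0 := by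
  let ric (x y : V) : ℝ := LinearMap.trace ℝ V ((R.flip y).flip x)
  have symm (x y : V) : ric x y = ric y x := by
    simp only [ric]
    rw [LinearMap.trace_eq_sum_inner _ (stdOrthonormalBasis ℝ V),
      LinearMap.trace_eq_sum_inner _ (stdOrthonormalBasis ℝ V)]
    refine Finset.sum_congr rfl fun i _ => ?_
    simp only [LinearMap.flip_apply]
    rw [real_inner_comm, pair, skew₁, LinearMap.neg_apply, inner_neg_left, skew₂, neg_neg]
  have hinv (x y : V) : ric (J x) (J y) = ric x y := by
    have : (R.flip (J y)).flip (J x) = -(J ∘ₗ ((R.flip y).flip x ∘ₗ J)) := by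
      ext z
      have := inv₁ (J z) y
      rw [hJ, map_neg, LinearMap.neg_apply] at this
      simp [comm, ← this]
    have h2 : J ∘ₗ J = -LinearMap.id := LinearMap.ext hJ
    simp only [ric]
    rw [this, map_neg, LinearMap.trace_comp_comm', LinearMap.comp_assoc, h2, LinearMap.comp_neg,
      map_neg, neg_neg, LinearMap.comp_id]
  have hJric (x y : V) : ric (J x) y = 0 := by
    -- Bianchi and the trace hypothesis give ric(Jx, y) = ric(Jy, x); symmetry and J-invariance give
    -- the opposite sign.
    have h1 : J ∘ₗ R x y = (R.flip y).flip (J x) - (R.flip x).flip (J y) := by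
      ext z
      have := bianchi x y z
      rw [skew₁ y z] at this
      simp only [LinearMap.comp_apply, LinearMap.sub_apply, LinearMap.flip_apply, comm, ← map_sub]
      congr 1
      rw [LinearMap.neg_apply] at this
      rw [← sub_eq_zero, ← this]
      abel
    have h2 := htr x y
    rw [h1, map_sub] at h2
    change ric (J x) y - ric (J y) x = 0 at h2
    have h3 := hinv (J y) x
    rw [hJ] at h3
    have h4 : ric (-y) (J x) = -ric y (J x) := by simp [ric]
    rw [h4, symm] at h3
    linarith
  have := hJric (-J x) y
  rwa [map_neg, hJ, neg_neg] at this

/-- A unitary frame of a Hermitian inner product on a complex vector space. -/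
theorem exists_unitary_frame {E : Type*} [AddCommGroup E] [Module ℂ E] [FiniteDimensional ℂ E]
    (g : E → E → ℝ) (symm : ∀ x y, g x y = g y x) (add : ∀ x y z, g (x + y) z = g x z + g y z)
    (smul : ∀ (c : ℝ) x y, g ((c : ℂ) • x) y = c * g x y) (pos : ∀ x, 0 ≤ g x x)
    (definite : ∀ x, g x x = 0 → x = 0)
    (inv : ∀ x y, g (Complex.I • x) (Complex.I • y) = g x y) :
    ∃ u : Fin (finrank ℂ E) → E, (∀ i j, g (u i) (u j) = if i = j then 1 else 0) ∧
      ∀ i j, g (u i) (Complex.I • u j) = 0 := by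
  have neg (x y : E) : g (-x) y = -g x y := by simpa using smul (-1) x y
  have hI (x y : E) : g (Complex.I • x) y = -g x (Complex.I • y) := by
    rw [← inv x, smul_smul, Complex.I_mul_I, neg_one_smul, symm _ (-y), neg, neg_neg, symm]
  -- The Hermitian form with real part g, conjugate linear in the first slot. The real and imaginary
  -- parts of its orthonormality relations are the two claims.
  let c : InnerProductSpace.Core ℂ E :=
    { inner := fun x y => ⟨g x y, -g x (Complex.I • y)⟩
      conj_inner_symm := fun x y => by
        apply Complex.ext
        · exact symm y x
        · simp only [Complex.conj_im, neg_neg]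
          rw [symm, hI]
      re_inner_nonneg := fun x => pos x
      add_left := fun x y z => by
        apply Complex.ext <;> simp [add]; ring
      smul_left := fun x y r => by
        have h (z : E) : g (r • x) z = r.re * g x z - r.im * g x (Complex.I • z) := by
          conv_lhs => rw [← Complex.re_add_im r, add_smul, mul_smul, add, smul, smul, hI]
          ring
        apply Complex.ext
        · simp [h]
        · simp only [h, smul_smul, Complex.I_mul_I, neg_one_smul, Complex.mul_im, Complex.conj_re,
            Complex.conj_im]
          rw [symm x (-y), neg, symm y]
          ring
      definite := fun x hx => definite x (congrArg Complex.re hx) }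
  obtain ⟨b, hb, -⟩ := c.exists_orthonormal_basis
  refine ⟨b, fun i j => ?_, fun i j => ?_⟩
  · have : g (b i) (b j) = Complex.re (if i = j then 1 else 0) := congrArg Complex.re (hb i j)
    rw [this]
    split_ifs <;> rfl
  · have : -g (b i) (Complex.I • b j) = Complex.im (if i = j then 1 else 0) :=
      congrArg Complex.im (hb i j)
    split_ifs at this <;> simpa using this

end Traces

namespace HermitianGeometry

open Filter Topology VectorField

/-! ### Smooth vector fields, Lie brackets and the complex structure -/

section SmoothFields

variable {E : Type*} [NormedAddCommGroup E] [NormedSpace ℂ E]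
  {M : Type*} [TopologicalSpace M] [ChartedSpace E M] [IsManifold 𝓘(ℂ, E) ω M]

namespace IsSmoothField

variable {X Y : Π x : M, TangentSpace 𝓘(ℝ, E) x}

theorem add (hX : IsSmoothField X) (hY : IsSmoothField Y) : IsSmoothField (X + Y) :=
  ContMDiff.add_section hX hY

theorem sub (hX : IsSmoothField X) (hY : IsSmoothField Y) : IsSmoothField (X - Y) :=
  ContMDiff.sub_section hX hY

theorem const_smul (c : ℝ) (hX : IsSmoothField X) : IsSmoothField (c • X) :=
  ContMDiff.const_smul_section hX

theorem smul {f : M → ℝ} (hf : ContMDiff 𝓘(ℝ, E) 𝓘(ℝ, ℝ) ∞ f) (hX : IsSmoothField X) :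
    IsSmoothField (f • X) :=
  ContMDiff.smul_section hf hX

theorem mdifferentiableAt (hX : IsSmoothField X) (x : M) :
    MDifferentiableAt 𝓘(ℝ, E) 𝓘(ℝ, E).tangent
      (fun x => (⟨x, X x⟩ : TangentBundle 𝓘(ℝ, E) M)) x :=
  ContMDiff.mdifferentiableAt hX (by simp)

theorem mlieBracket [FiniteDimensional ℂ E] (hX : IsSmoothField X) (hY : IsSmoothField Y) :
    IsSmoothField (mlieBracket 𝓘(ℝ, E) X Y) := by
  have : FiniteDimensional ℝ E := FiniteDimensional.complexToReal E
  have : CompleteSpace E := FiniteDimensional.complete ℝ E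
  have : IsManifold 𝓘(ℝ, E) (((⊤ : ℕ∞) : ℕ∞ω) + 1) M := isManifold_real_of_complex E M
  have : IsManifold 𝓘(ℝ, E) (minSmoothness ℝ 2) M := by
    simp only [minSmoothness_of_isRCLikeNormedField]
    infer_instance
  exact ContDiff.mlieBracket_vectorField (n := ⊤) (m := ⊤) hX hY (by simp)

theorem covariantDerivative {D : Connection E M} (hD : D.ContMDiffCovariantDerivative ∞)
    (hX : IsSmoothField X) (hY : IsSmoothField Y) : IsSmoothField (fun x => D Y x (X x)) := by
  have h := hD.contMDiff.contMDiff (σ := Y) hY.contMDiffOn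
  exact ContMDiff.clm_bundle_apply (contMDiffOn_univ.1 h) hX

end IsSmoothField

/-- A tangent vector extends to a global smooth vector field that has constant components near the
base point. -/
theorem exists_isSmoothField_eventuallyEq_extend [FiniteDimensional ℂ E] [T2Space M] {x : M}
    (v : TangentSpace 𝓘(ℝ, E) x) :
    ∃ X : Π y : M, TangentSpace 𝓘(ℝ, E) y, IsSmoothField X ∧
      ∀ᶠ y in 𝓝 x, X y = FiberBundle.extend E v y := by
  have : FiniteDimensional ℝ E := FiniteDimensional.complexToReal E
  obtain ⟨s, hs, hsv⟩ := FiberBundle.exists_contMDiffOn_extend (k := ∞) 𝓘(ℝ, E) E v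
  obtain ⟨u, hus, hu, hxu⟩ := mem_nhds_iff.1 hs
  -- A bump function supported where the constant-component extension is smooth, equal to 1 near x.
  obtain ⟨f, -, hf⟩ := (SmoothBumpFunction.nhds_basis_tsupport (I := 𝓘(ℝ, E)) x).mem_iff.1
    (hu.mem_nhds hxu)
  refine ⟨fun y => f y • FiberBundle.extend E v y,
    ContMDiffOn.smul_section_of_tsupport f.contMDiff.contMDiffOn hu hf (hsv.mono hus), ?_⟩
  filter_upwards [f.eventuallyEq_one] with y hy
  simp [hy]

theorem exists_isSmoothField_apply_eq [FiniteDimensional ℂ E] [T2Space M] {x : M}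
    (v : TangentSpace 𝓘(ℝ, E) x) :
    ∃ X : Π y : M, TangentSpace 𝓘(ℝ, E) y, IsSmoothField X ∧ X x = v := by
  obtain ⟨X, hX, h⟩ := exists_isSmoothField_eventuallyEq_extend v
  exact ⟨X, hX, by simpa using h.self_of_nhds⟩

/-- The Lie bracket of vector fields is the commutator of derivations. -/
theorem mvfderiv_mlieBracket [FiniteDimensional ℂ E] [T2Space M]
    {X Y : Π x : M, TangentSpace 𝓘(ℝ, E) x} {f : M → ℝ}
    (hX : IsSmoothField X) (hY : IsSmoothField Y) (hf : ContMDiff 𝓘(ℝ, E) 𝓘(ℝ, ℝ) ∞ f)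
    (hfX : MDifferentiable 𝓘(ℝ, E) 𝓘(ℝ, ℝ) (fun y => mvfderiv 𝓘(ℝ, E) f y (X y)))
    (hfY : MDifferentiable 𝓘(ℝ, E) 𝓘(ℝ, ℝ) (fun y => mvfderiv 𝓘(ℝ, E) f y (Y y))) (x : M) :
    mvfderiv 𝓘(ℝ, E) f x (mlieBracket 𝓘(ℝ, E) X Y x)
      = mvfderiv 𝓘(ℝ, E) (fun y => mvfderiv 𝓘(ℝ, E) f y (Y y)) x (X x)
        - mvfderiv 𝓘(ℝ, E) (fun y => mvfderiv 𝓘(ℝ, E) f y (X y)) x (Y x) := by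
  have : FiniteDimensional ℝ E := FiniteDimensional.complexToReal E
  have : CompleteSpace E := FiniteDimensional.complete ℝ E
  have : IsManifold 𝓘(ℝ, E) (minSmoothness ℝ 3) M := by
    simp only [minSmoothness_of_isRCLikeNormedField]
    infer_instance
  -- The argument compares coefficients of a field Z with Z(x) ≠ 0; if the tangent space is zero,
  -- everything vanishes.
  by_cases hv : ∃ v : TangentSpace 𝓘(ℝ, E) x, v ≠ 0
  swap
  · push Not at hv
    rw [hv (mlieBracket 𝓘(ℝ, E) X Y x), hv (X x), hv (Y x)]
    simp
  obtain ⟨v, hv⟩ := hv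
  obtain ⟨Z, hZ, rfl⟩ := exists_isSmoothField_apply_eq v
  have hfd (y : M) : MDifferentiableAt 𝓘(ℝ, E) 𝓘(ℝ, ℝ) f y := hf.mdifferentiableAt (by simp)
  have key (A B : Π x : M, TangentSpace 𝓘(ℝ, E) x) (hA : IsSmoothField A) (hB : IsSmoothField B)
      (hfB : MDifferentiable 𝓘(ℝ, E) 𝓘(ℝ, ℝ) (fun y => mvfderiv 𝓘(ℝ, E) f y (B y))) :
      mlieBracket 𝓘(ℝ, E) A (mlieBracket 𝓘(ℝ, E) B (f • Z)) x
        = mvfderiv 𝓘(ℝ, E) (fun y => mvfderiv 𝓘(ℝ, E) f y (B y)) x (A x) • Z x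
          + mvfderiv 𝓘(ℝ, E) f x (B x) • mlieBracket 𝓘(ℝ, E) A Z x
          + mvfderiv 𝓘(ℝ, E) f x (A x) • mlieBracket 𝓘(ℝ, E) B Z x
          + f x • mlieBracket 𝓘(ℝ, E) A (mlieBracket 𝓘(ℝ, E) B Z) x := by
    have h1 : mlieBracket 𝓘(ℝ, E) B (f • Z)
        = (fun y => mvfderiv 𝓘(ℝ, E) f y (B y)) • Z + f • mlieBracket 𝓘(ℝ, E) B Z := by
      funext y
      rw [mlieBracket_smul_right (hfd y) (hZ.mdifferentiableAt y)]
      rfl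
    rw [h1, mlieBracket_add_right, mlieBracket_smul_right (hfB x) (hZ.mdifferentiableAt x),
      mlieBracket_smul_right (hfd x) ((hB.mlieBracket hZ).mdifferentiableAt x)]
    · abel
    · exact (hfB x).smul_section (hZ.mdifferentiableAt x)
    · exact ((hB.mlieBracket hZ).smul hf).mdifferentiableAt x
  have hle {A : Π x : M, TangentSpace 𝓘(ℝ, E) x} (hA : IsSmoothField A) :
      ContMDiffAt 𝓘(ℝ, E) 𝓘(ℝ, E).tangent (minSmoothness ℝ 2)
        (fun x => (⟨x, A x⟩ : TangentBundle 𝓘(ℝ, E) M)) x := by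
    refine (ContMDiff.contMDiffAt hA).of_le ?_
    simp only [minSmoothness_of_isRCLikeNormedField]
    exact WithTop.coe_le_coe.2 (le_top : (2 : ℕ∞) ≤ ⊤)
  -- Jacobi for X, Y, fZ minus f times Jacobi for X, Y, Z leaves only a multiple of Z(x), whose
  -- coefficient is the difference of the two sides.
  have e1 := leibniz_identity_mlieBracket_apply (hle hX) (hle hY) (hle (hZ.smul hf))
  have e2 := leibniz_identity_mlieBracket_apply (hle hX) (hle hY) (hle hZ)
  rw [key X Y hX hY hfY, key Y X hY hX hfX,
    mlieBracket_smul_right (hfd x) (hZ.mdifferentiableAt x), e2] at e1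
  have e3 : (mvfderiv 𝓘(ℝ, E) f x (mlieBracket 𝓘(ℝ, E) X Y x)
      - (mvfderiv 𝓘(ℝ, E) (fun y => mvfderiv 𝓘(ℝ, E) f y (Y y)) x (X x)
        - mvfderiv 𝓘(ℝ, E) (fun y => mvfderiv 𝓘(ℝ, E) f y (X y)) x (Y x))) • Z x = 0 := by
    rw [← sub_eq_zero] at e1
    rw [← neg_eq_zero, ← e1]
    module
  exact sub_eq_zero.1 ((smul_eq_zero.1 e3).resolve_right hv)

/-- The coordinate changes of the tangent bundle of a complex manifold commute with the complex
structure. -/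
theorem trivializationAt_tangentJ {x y : M} (hy : y ∈ (chartAt E x).source)
    (v : TangentSpace 𝓘(ℝ, E) y) :
    (trivializationAt E (TangentSpace 𝓘(ℝ, E)) x ⟨y, tangentJ y v⟩).2
      = Complex.I • (trivializationAt E (TangentSpace 𝓘(ℝ, E)) x ⟨y, v⟩).2 := by
  have h1 := (contDiffGroupoid ω 𝓘(ℂ, E)).compatible (chart_mem_atlas E y) (chart_mem_atlas E x)
  rw [contDiffGroupoid, mem_groupoid_of_pregroupoid] at h1
  have h2 : ContDiffOn ℂ ω (chartAt E x ∘ (chartAt E y).symm)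
      ((chartAt E y).symm ≫ₕ chartAt E x).source := by
    simpa [contDiffPregroupoid] using h1.1
  have hmem : chartAt E y y ∈ ((chartAt E y).symm ≫ₕ chartAt E x).source := by
    simp [hy]
  have h3 : DifferentiableAt ℂ (chartAt E x ∘ (chartAt E y).symm) (chartAt E y y) :=
    (h2.contDiffAt ((OpenPartialHomeomorph.open_source _).mem_nhds hmem)).differentiableAt
      (by simp)
  -- The transition map is holomorphic, so its real differential is complex linear.
  have h4 : fderivWithin ℝ ((chartAt E x).extend 𝓘(ℝ, E) ∘ ((chartAt E y).extend 𝓘(ℝ, E)).symm)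
      (Set.range 𝓘(ℝ, E)) ((chartAt E y).extend 𝓘(ℝ, E) y)
      = (fderiv ℂ (chartAt E x ∘ (chartAt E y).symm) (chartAt E y y)).restrictScalars ℝ := by
    simp only [modelWithCornersSelf_coe, Set.range_id, fderivWithin_univ, mfld_simps]
    exact h3.fderiv_restrictScalars ℝ
  simp only [TangentBundle.trivializationAt_apply]
  rw [h4]
  exact ContinuousLinearMap.map_smul (fderiv ℂ (chartAt E x ∘ (chartAt E y).symm) (chartAt E y y))
    Complex.I (show E from v)

/-- The complex structure of a complex manifold is smooth. -/
theorem IsSmoothField.tangentJ {X : Π x : M, TangentSpace 𝓘(ℝ, E) x} (hX : IsSmoothField X) :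
    IsSmoothField (fun x => tangentJ x (X x)) := by
  intro x
  have h := (contMDiffAt_section _).1 (hX x)
  rw [contMDiffAt_section]
  have hI := ((Complex.I • ContinuousLinearMap.id ℝ E : E →L[ℝ] E).contMDiff (n := ∞)).contMDiffAt.comp
    x h
  refine hI.congr_of_eventuallyEq ?_
  filter_upwards [(chartAt E x).open_source.mem_nhds (mem_chart_source E x)] with y hy
  exact trivializationAt_tangentJ hy _

end SmoothFields

/-! ### The curvature of vector fields and its tensoriality -/

section CurvatureField

variable {E : Type*} [NormedAddCommGroup E] [NormedSpace ℂ E] [FiniteDimensional ℂ E]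
  {M : Type*} [TopologicalSpace M] [ChartedSpace E M] [IsManifold 𝓘(ℂ, E) ω M]
  {D : Connection E M} {X X' Y Y' Z Z' W : Π x : M, TangentSpace 𝓘(ℝ, E) x}

omit [FiniteDimensional ℂ E] in
theorem curvatureField_swap (x : M) :
    curvatureField D X Y Z x = -curvatureField D Y X Z x := by
  simp only [curvatureField]
  rw [mlieBracket_swap_apply, map_neg]
  abel

omit [FiniteDimensional ℂ E] in
theorem curvature_swap (x : M) (u v w : TangentSpace 𝓘(ℝ, E) x) :
    curvature D x u v w = -curvature D x v u w :=
  curvatureField_swap x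

omit [FiniteDimensional ℂ E] in
theorem mdifferentiableAt_field_congr {x : M}
    (hX : MDifferentiableAt 𝓘(ℝ, E) 𝓘(ℝ, E).tangent
      (fun x => (⟨x, X x⟩ : TangentBundle 𝓘(ℝ, E) M)) x)
    (h : ∀ᶠ y in 𝓝 x, X' y = X y) :
    MDifferentiableAt 𝓘(ℝ, E) 𝓘(ℝ, E).tangent
      (fun x => (⟨x, X' x⟩ : TangentBundle 𝓘(ℝ, E) M)) x :=
  hX.congr_of_eventuallyEq (h.mono fun y hy => by simp [hy])

omit [FiniteDimensional ℂ E] in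
/-- The curvature of a smooth connection is local. -/
theorem curvatureField_congr (hD : D.ContMDiffCovariantDerivative ∞) (hX : IsSmoothField X)
    (hY : IsSmoothField Y) (hZ : IsSmoothField Z) {x : M} (hXX' : ∀ᶠ y in 𝓝 x, X' y = X y)
    (hYY' : ∀ᶠ y in 𝓝 x, Y' y = Y y) (hZZ' : ∀ᶠ y in 𝓝 x, Z' y = Z y) :
    curvatureField D X' Y' Z' x = curvatureField D X Y Z x := by
  -- Second derivatives occur, so the first derivatives must agree on a neighbourhood and not just
  -- at x.
  have hDZ : ∀ᶠ y in 𝓝 x, D Z' y = D Z y := by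
    filter_upwards [hZZ'.eventually_nhds] with y hy
    exact D.isCovariantDerivativeOn.congr_of_eventuallyEq
      (mdifferentiableAt_field_congr (hZ.mdifferentiableAt y) hy) (hZ.mdifferentiableAt y)
      univ_mem hy
  have h {A A' : Π x : M, TangentSpace 𝓘(ℝ, E) x} (hA : IsSmoothField A)
      (hAA' : ∀ᶠ y in 𝓝 x, A' y = A y) :
      D (fun y => D Z' y (A' y)) x = D (fun y => D Z y (A y)) x := by
    have heq : ∀ᶠ y in 𝓝 x, D Z' y (A' y) = D Z y (A y) := by
      filter_upwards [hDZ, hAA'] with y h1 h2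
      rw [h1, h2]
    have hs := (hA.covariantDerivative hD hZ).mdifferentiableAt x
    exact D.isCovariantDerivativeOn.congr_of_eventuallyEq
      (mdifferentiableAt_field_congr hs heq) hs univ_mem heq
  simp only [curvatureField]
  rw [h hX hXX', h hY hYY', hDZ.self_of_nhds, hXX'.self_of_nhds, hYY'.self_of_nhds,
    EventuallyEq.mlieBracket_vectorField_eq hXX' hYY']

/-- The curvature of a smooth connection is tensorial in its first argument. -/
theorem tensorialAt_curvatureField (hD : D.ContMDiffCovariantDerivative ∞)
    (hZ : IsSmoothField Z) (x : M) :
    TensorialAt 𝓘(ℝ, E) E (fun X => curvatureField D X Y Z x) x := by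
  have : FiniteDimensional ℝ E := FiniteDimensional.complexToReal E
  have : CompleteSpace E := FiniteDimensional.complete ℝ E
  have hDZ := contMDiffOn_univ.1 (hD.contMDiff.contMDiff (σ := Z) hZ.contMDiffOn)
  have hd {A : Π x : M, TangentSpace 𝓘(ℝ, E) x}
      (hA : MDifferentiableAt 𝓘(ℝ, E) 𝓘(ℝ, E).tangent
        (fun x => (⟨x, A x⟩ : TangentBundle 𝓘(ℝ, E) M)) x) :
      MDifferentiableAt 𝓘(ℝ, E) 𝓘(ℝ, E).tangent
        (fun x => (⟨x, D Z x (A x)⟩ : TangentBundle 𝓘(ℝ, E) M)) x :=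
    (hDZ.mdifferentiableAt (by simp)).clm_bundle_apply hA
  refine ⟨fun {f A} hf hA => ?_, fun {A B} hA hB => ?_⟩
  · have h1 : (fun y => D Z y ((f • A) y)) = f • fun y => D Z y (A y) := by
      funext y
      exact ContinuousLinearMap.map_smul (D Z y) (f y) (A y)
    simp only [curvatureField, h1]
    rw [D.isCovariantDerivativeOn.leibniz (hd hA) hf, mlieBracket_smul_left hf hA]
    simp only [Pi.smul_apply', map_smul, map_add, _root_.add_apply,
      _root_.smul_apply, ContinuousLinearMap.smulRight_apply, neg_smul, map_neg]
    module
  · have h1 : (fun y => D Z y ((A + B) y)) = (fun y => D Z y (A y)) + fun y => D Z y (B y) := by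
      funext y
      exact ContinuousLinearMap.map_add (D Z y) (A y) (B y)
    simp only [curvatureField, h1]
    rw [D.isCovariantDerivativeOn.add (hd hA) (hd hB), mlieBracket_add_left hA hB]
    simp only [Pi.add_apply, map_add, _root_.add_apply]
    abel

variable [RiemannianBundle (fun x : M => TangentSpace 𝓘(ℝ, E) x)]

/-- The curvature field commutes with the complex structure. -/
theorem IsBismutConnection.curvatureField_tangentJ (hD : IsBismutConnection D)
    (hX : IsSmoothField X) (hY : IsSmoothField Y) (hZ : IsSmoothField Z) (x : M) :
    curvatureField D X Y (fun y => tangentJ y (Z y)) x = tangentJ x (curvatureField D X Y Z x) := by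
  simp only [curvatureField, hD.complex Z hZ]
  rw [hD.complex _ (hY.covariantDerivative hD.smooth hZ),
    hD.complex _ (hX.covariantDerivative hD.smooth hZ), map_sub, map_sub]

variable [T2Space M]
  [IsContMDiffRiemannianBundle 𝓘(ℝ, E) ∞ E (fun x : M => TangentSpace 𝓘(ℝ, E) x)]

/-- The curvature of a metric connection is skew-symmetric in its last two arguments. -/
theorem IsBismutConnection.inner_curvatureField (hD : IsBismutConnection D)
    (hX : IsSmoothField X) (hY : IsSmoothField Y) (hZ : IsSmoothField Z) (hW : IsSmoothField W)
    (x : M) :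
    (inner ℝ (curvatureField D X Y Z x) (W x) : ℝ)
      = -inner ℝ (Z x) (curvatureField D X Y W x) := by
  have hsm {A B : Π x : M, TangentSpace 𝓘(ℝ, E) x} (hA : IsSmoothField A)
      (hB : IsSmoothField B) :
      ContMDiff 𝓘(ℝ, E) 𝓘(ℝ, ℝ) ∞ (fun y => (inner ℝ (A y) (B y) : ℝ)) :=
    ContMDiff.inner_bundle hA hB
  have hmd {A B : Π x : M, TangentSpace 𝓘(ℝ, E) x} (hA : IsSmoothField A)
      (hB : IsSmoothField B) :
      MDifferentiable 𝓘(ℝ, E) 𝓘(ℝ, ℝ) (fun y => (inner ℝ (A y) (B y) : ℝ)) :=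
    (hsm hA hB).mdifferentiable (by simp)
  have h1 {A : Π x : M, TangentSpace 𝓘(ℝ, E) x} :
      (fun y => mvfderiv 𝓘(ℝ, E) (fun y => (inner ℝ (Z y) (W y) : ℝ)) y (A y))
        = fun y => (inner ℝ (D Z y (A y)) (W y) : ℝ) + inner ℝ (Z y) (D W y (A y)) :=
    funext fun y => hD.metric Z W hZ hW y (A y)
  have hDA {A B : Π x : M, TangentSpace 𝓘(ℝ, E) x} (hA : IsSmoothField A)
      (hB : IsSmoothField B) : IsSmoothField (fun x => D B x (A x)) :=
    hA.covariantDerivative hD.smooth hB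
  have hmd2 {A : Π x : M, TangentSpace 𝓘(ℝ, E) x} (hA : IsSmoothField A) :
      MDifferentiable 𝓘(ℝ, E) 𝓘(ℝ, ℝ)
        (fun y => mvfderiv 𝓘(ℝ, E) (fun y => (inner ℝ (Z y) (W y) : ℝ)) y (A y)) := by
    rw [h1]
    exact (hmd (hDA hA hZ) hW).add (hmd hZ (hDA hA hW))
  have h2 {A B : Π x : M, TangentSpace 𝓘(ℝ, E) x} (hA : IsSmoothField A)
      (hB : IsSmoothField B) :
      mvfderiv 𝓘(ℝ, E) (fun y => mvfderiv 𝓘(ℝ, E) (fun y => (inner ℝ (Z y) (W y) : ℝ)) y (B y)) x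
          (A x)
        = (inner ℝ (D (fun y => D Z y (B y)) x (A x)) (W x) : ℝ)
          + inner ℝ (D Z x (B x)) (D W x (A x))
          + (inner ℝ (D Z x (A x)) (D W x (B x))
          + inner ℝ (Z x) (D (fun y => D W y (B y)) x (A x))) := by
    rw [h1, mvfderiv_fun_add (hmd (hDA hB hZ) hW x) (hmd hZ (hDA hB hW) x),
      _root_.add_apply, hD.metric _ _ (hDA hB hZ) hW, hD.metric _ _ hZ (hDA hB hW)]
  -- [X, Y] acts on ⟨Z, W⟩ as a commutator; the products of first derivatives are symmetric in X, Y
  -- and cancel.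
  have key := mvfderiv_mlieBracket hX hY (hsm hZ hW) (hmd2 hX) (hmd2 hY) x
  rw [h2 hX hY, h2 hY hX, hD.metric Z W hZ hW] at key
  simp only [curvatureField, inner_sub_left, inner_sub_right]
  linarith

/-- The curvature tensor computes the curvature field of smooth vector fields. -/
theorem IsBismutConnection.curvature_apply (hD : IsBismutConnection D)
    (hX : IsSmoothField X) (hY : IsSmoothField Y) (hZ : IsSmoothField Z) (x : M) :
    curvature D x (X x) (Y x) (Z x) = curvatureField D X Y Z x := by
  have : FiniteDimensional ℝ E := FiniteDimensional.complexToReal E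
  obtain ⟨X', hX', hXe⟩ := exists_isSmoothField_eventuallyEq_extend (X x)
  obtain ⟨Y', hY', hYe⟩ := exists_isSmoothField_eventuallyEq_extend (Y x)
  obtain ⟨Z', hZ', hZe⟩ := exists_isSmoothField_eventuallyEq_extend (Z x)
  have hXx : X' x = X x := by simpa using hXe.self_of_nhds
  have hYx : Y' x = Y x := by simpa using hYe.self_of_nhds
  have hZx : Z' x = Z x := by simpa using hZe.self_of_nhds
  have hfirst {A A' B C : Π x : M, TangentSpace 𝓘(ℝ, E) x} (hA : IsSmoothField A)
      (hA' : IsSmoothField A') (hC : IsSmoothField C) (h : A' x = A x) :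
      curvatureField D A' B C x = curvatureField D A B C x :=
    (tensorialAt_curvatureField hD.smooth hC x).pointwise (hA'.mdifferentiableAt x)
      (hA.mdifferentiableAt x) h
  -- The first slot is replaced by tensoriality and the second by antisymmetry. For the third,
  -- pairing with a field W and using skew-adjointness leaves only the value of Z at x.
  rw [curvature, curvatureField_congr hD.smooth hX' hY' hZ' (hXe.mono fun _ h => h.symm)
    (hYe.mono fun _ h => h.symm) (hZe.mono fun _ h => h.symm), hfirst hX hX' hZ' hXx,
    curvatureField_swap, hfirst hY hY' hZ' hYx, ← curvatureField_swap]
  refine ext_inner_right ℝ fun v => ?_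
  obtain ⟨W, hW, rfl⟩ := exists_isSmoothField_apply_eq v
  rw [hD.inner_curvatureField hX hY hZ' hW, hD.inner_curvatureField hX hY hZ hW, hZx]

end CurvatureField

/-! ### The curvature tensor at a point and the Ricci identity -/

section CurvatureTensor

variable {E : Type*} [NormedAddCommGroup E] [NormedSpace ℂ E] [FiniteDimensional ℂ E]
  {M : Type*} [TopologicalSpace M] [T2Space M] [ChartedSpace E M] [IsManifold 𝓘(ℂ, E) ω M]
  [RiemannianBundle (fun x : M => TangentSpace 𝓘(ℝ, E) x)]
  [IsContMDiffRiemannianBundle 𝓘(ℝ, E) ∞ E (fun x : M => TangentSpace 𝓘(ℝ, E) x)]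
  {D : Connection E M} (hD : IsBismutConnection D)
include hD

namespace IsBismutConnection

theorem curvature_add_left (x : M) (u u' v w : TangentSpace 𝓘(ℝ, E) x) :
    curvature D x (u + u') v w = curvature D x u v w + curvature D x u' v w := by
  obtain ⟨X, hX, rfl⟩ := exists_isSmoothField_apply_eq u
  obtain ⟨X', hX', rfl⟩ := exists_isSmoothField_apply_eq u'
  obtain ⟨Y, hY, rfl⟩ := exists_isSmoothField_apply_eq v
  obtain ⟨Z, hZ, rfl⟩ := exists_isSmoothField_apply_eq w
  rw [← Pi.add_apply, hD.curvature_apply (hX.add hX') hY hZ, hD.curvature_apply hX hY hZ,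
    hD.curvature_apply hX' hY hZ]
  exact (tensorialAt_curvatureField hD.smooth hZ x).add (hX.mdifferentiableAt x)
    (hX'.mdifferentiableAt x)

theorem curvature_smul_left (x : M) (c : ℝ) (u v w : TangentSpace 𝓘(ℝ, E) x) :
    curvature D x (c • u) v w = c • curvature D x u v w := by
  obtain ⟨X, hX, rfl⟩ := exists_isSmoothField_apply_eq u
  obtain ⟨Y, hY, rfl⟩ := exists_isSmoothField_apply_eq v
  obtain ⟨Z, hZ, rfl⟩ := exists_isSmoothField_apply_eq w
  rw [← Pi.smul_apply, hD.curvature_apply (hX.const_smul c) hY hZ, hD.curvature_apply hX hY hZ]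
  exact (tensorialAt_curvatureField hD.smooth hZ x).smul (f := fun _ => c) mdifferentiableAt_const
    (hX.mdifferentiableAt x)

theorem inner_curvature (x : M) (u v w z : TangentSpace 𝓘(ℝ, E) x) :
    (inner ℝ (curvature D x u v w) z : ℝ) = -inner ℝ w (curvature D x u v z) := by
  obtain ⟨X, hX, rfl⟩ := exists_isSmoothField_apply_eq u
  obtain ⟨Y, hY, rfl⟩ := exists_isSmoothField_apply_eq v
  obtain ⟨Z, hZ, rfl⟩ := exists_isSmoothField_apply_eq w
  obtain ⟨W, hW, rfl⟩ := exists_isSmoothField_apply_eq z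
  rw [hD.curvature_apply hX hY hZ, hD.curvature_apply hX hY hW, hD.inner_curvatureField hX hY hZ hW]

theorem curvature_tangentJ (x : M) (u v w : TangentSpace 𝓘(ℝ, E) x) :
    curvature D x u v (tangentJ x w) = tangentJ x (curvature D x u v w) := by
  obtain ⟨X, hX, rfl⟩ := exists_isSmoothField_apply_eq u
  obtain ⟨Y, hY, rfl⟩ := exists_isSmoothField_apply_eq v
  obtain ⟨Z, hZ, rfl⟩ := exists_isSmoothField_apply_eq w
  rw [hD.curvature_apply hX hY hZ, ← hD.curvatureField_tangentJ hX hY hZ]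
  exact hD.curvature_apply hX hY hZ.tangentJ x

/-- Skew-adjointness moves the third argument out of the curvature, where only bilinearity of the
metric is needed. -/
theorem curvature_add_right (x : M) (u v w w' : TangentSpace 𝓘(ℝ, E) x) :
    curvature D x u v (w + w') = curvature D x u v w + curvature D x u v w' := by
  refine ext_inner_right ℝ fun z => ?_
  simp only [inner_add_left, hD.inner_curvature]
  ring

theorem curvature_smul_right (x : M) (c : ℝ) (u v w : TangentSpace 𝓘(ℝ, E) x) :
    curvature D x u v (c • w) = c • curvature D x u v w := by
  refine ext_inner_right ℝ fun z => ?_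
  simp only [real_inner_smul_left, hD.inner_curvature]
  ring

/-- The curvature tensor at a point, as a bilinear map with values in the endomorphisms of the
tangent space. -/
noncomputable def curvatureHom (x : M) : TangentSpace 𝓘(ℝ, E) x →ₗ[ℝ] TangentSpace 𝓘(ℝ, E) x →ₗ[ℝ]
    Module.End ℝ (TangentSpace 𝓘(ℝ, E) x) :=
  LinearMap.mk₂ ℝ
    (fun u v =>
      { toFun := fun w => curvature D x u v w
        map_add' := hD.curvature_add_right x u v
        map_smul' := fun c w => hD.curvature_smul_right x c u v w })
    (fun u u' v => LinearMap.ext fun w => hD.curvature_add_left x u u' v w)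
    (fun c u v => LinearMap.ext fun w => hD.curvature_smul_left x c u v w)
    (fun u v v' => LinearMap.ext fun w => by
      change curvature D x u (v + v') w = curvature D x u v w + curvature D x u v' w
      rw [curvature_swap, hD.curvature_add_left, curvature_swap x v, curvature_swap x v']
      abel)
    (fun c u v => LinearMap.ext fun w => by
      change curvature D x u (c • v) w = c • curvature D x u v w
      rw [curvature_swap, hD.curvature_smul_left, curvature_swap x v, smul_neg, neg_neg])

/-- Allows R(X, Y)Z to be differentiated again and inserted as a field into the curvature, as the
Ricci identity requires. -/
theorem isSmoothField_curvature {X Y Z : Π x : M, TangentSpace 𝓘(ℝ, E) x}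
    (hX : IsSmoothField X) (hY : IsSmoothField Y) (hZ : IsSmoothField Z) :
    IsSmoothField (fun x => curvature D x (X x) (Y x) (Z x)) := by
  have h : (fun x => curvature D x (X x) (Y x) (Z x)) = (fun y => D (fun y => D Z y (Y y)) y (X y))
      - (fun y => D (fun y => D Z y (X y)) y (Y y))
      - (fun y => D Z y (VectorField.mlieBracket 𝓘(ℝ, E) X Y y)) :=
    funext fun x => hD.curvature_apply hX hY hZ x
  rw [h]
  exact ((hX.covariantDerivative hD.smooth (hY.covariantDerivative hD.smooth hZ)).sub
    (hY.covariantDerivative hD.smooth (hX.covariantDerivative hD.smooth hZ))).sub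
    ((hX.mlieBracket hY).covariantDerivative hD.smooth hZ)

/-- A parallel curvature tensor is annihilated by its own curvature endomorphisms. -/
theorem curvature_curvature (hR : ParallelCurvature D) (x : M)
    (a b u v w : TangentSpace 𝓘(ℝ, E) x) :
    curvature D x a b (curvature D x u v w)
      = curvature D x (curvature D x a b u) v w + curvature D x u (curvature D x a b v) w
        + curvature D x u v (curvature D x a b w) := by
  obtain ⟨A, hA, rfl⟩ := exists_isSmoothField_apply_eq a
  obtain ⟨B, hB, rfl⟩ := exists_isSmoothField_apply_eq b
  obtain ⟨X, hX, rfl⟩ := exists_isSmoothField_apply_eq u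
  obtain ⟨Y, hY, rfl⟩ := exists_isSmoothField_apply_eq v
  obtain ⟨Z, hZ, rfl⟩ := exists_isSmoothField_apply_eq w
  have hsm {A B : Π x : M, TangentSpace 𝓘(ℝ, E) x} (hA : IsSmoothField A)
      (hB : IsSmoothField B) : IsSmoothField (fun x => D B x (A x)) :=
    hA.covariantDerivative hD.smooth hB
  have par {V X Y Z : Π x : M, TangentSpace 𝓘(ℝ, E) x} (hV : IsSmoothField V)
      (hX : IsSmoothField X) (hY : IsSmoothField Y) (hZ : IsSmoothField Z) (y : M) :
      D (fun y => curvature D y (X y) (Y y) (Z y)) y (V y)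
        = curvature D y (D X y (V y)) (Y y) (Z y) + curvature D y (X y) (D Y y (V y)) (Z y)
          + curvature D y (X y) (Y y) (D Z y (V y)) := by
    rw [← sub_eq_zero, ← hR V X Y Z hV hX hY hZ y]
    abel
  have hS := hD.isSmoothField_curvature hX hY hZ
  -- The six terms that differentiate two different arguments are together symmetric in V and W, so
  -- they cancel in the commutator.
  have second {V W : Π x : M, TangentSpace 𝓘(ℝ, E) x} (hV : IsSmoothField V)
      (hW : IsSmoothField W) :
      D (fun y => D (fun y => curvature D y (X y) (Y y) (Z y)) y (W y)) x (V x)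
        = (curvature D x (D (fun y => D X y (W y)) x (V x)) (Y x) (Z x)
            + curvature D x (D X x (W x)) (D Y x (V x)) (Z x)
            + curvature D x (D X x (W x)) (Y x) (D Z x (V x)))
          + (curvature D x (D X x (V x)) (D Y x (W x)) (Z x)
            + curvature D x (X x) (D (fun y => D Y y (W y)) x (V x)) (Z x)
            + curvature D x (X x) (D Y x (W x)) (D Z x (V x)))
          + (curvature D x (D X x (V x)) (Y x) (D Z x (W x))
            + curvature D x (X x) (D Y x (V x)) (D Z x (W x))
            + curvature D x (X x) (Y x) (D (fun y => D Z y (W y)) x (V x))) := by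
    have h1 := hD.isSmoothField_curvature (hsm hW hX) hY hZ
    have h2 := hD.isSmoothField_curvature hX (hsm hW hY) hZ
    have h3 := hD.isSmoothField_curvature hX hY (hsm hW hZ)
    have hfun : (fun y => D (fun y => curvature D y (X y) (Y y) (Z y)) y (W y))
        = (fun y => curvature D y (D X y (W y)) (Y y) (Z y))
          + (fun y => curvature D y (X y) (D Y y (W y)) (Z y))
          + (fun y => curvature D y (X y) (Y y) (D Z y (W y))) :=
      funext fun y => par hW hX hY hZ y
    rw [hfun, D.isCovariantDerivativeOn.add ((h1.add h2).mdifferentiableAt x)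
      (h3.mdifferentiableAt x), D.isCovariantDerivativeOn.add (h1.mdifferentiableAt x)
      (h2.mdifferentiableAt x), _root_.add_apply, _root_.add_apply,
      par hV (hsm hW hX) hY hZ, par hV hX (hsm hW hY) hZ, par hV hX hY (hsm hW hZ)]
  have e := hD.curvature_apply hA hB hS x
  rw [curvatureField, second hA hB, second hB hA, par (hA.mlieBracket hB) hX hY hZ] at e
  rw [e, hD.curvature_apply hA hB hX, hD.curvature_apply hA hB hY, hD.curvature_apply hA hB hZ]
  simp only [curvatureField]
  change _ = hD.curvatureHom x _ _ _ + hD.curvatureHom x _ _ _ + hD.curvatureHom x _ _ _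
  simp only [map_sub, LinearMap.sub_apply]
  simp only [curvatureHom, LinearMap.mk₂_apply, LinearMap.coe_mk, AddHom.coe_mk]
  abel

end IsBismutConnection

end CurvatureTensor

/-! ### Passage to real identities and flatness -/

section Flat

variable {E : Type*} [NormedAddCommGroup E] [NormedSpace ℂ E]
  {M : Type*} [TopologicalSpace M] [ChartedSpace E M]

theorem tangentJ_tangentJ {x : M} (u : TangentSpace 𝓘(ℝ, E) x) :
    tangentJ x (tangentJ x u) = -u := by
  change Complex.I • Complex.I • (show E from u) = -(show E from u)
  rw [smul_smul, Complex.I_mul_I, neg_one_smul]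

/-- The `(1, 0)`-vector `u - i J u`. -/
noncomputable def toType10 {x : M} (u : TangentSpace 𝓘(ℝ, E) x) : ComplexTangent E x :=
  (u, -tangentJ x u)

theorem isType10_toType10 {x : M} (u : TangentSpace 𝓘(ℝ, E) x) : IsType10 (toType10 u) := by
  simp [IsType10, toType10, tangentJ_tangentJ]

variable [FiniteDimensional ℂ E] [T2Space M] [IsManifold 𝓘(ℂ, E) ω M]
  [RiemannianBundle (fun x : M => TangentSpace 𝓘(ℝ, E) x)]
  [IsContMDiffRiemannianBundle 𝓘(ℝ, E) ∞ E (fun x : M => TangentSpace 𝓘(ℝ, E) x)]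
  {D : Connection E M}

omit [FiniteDimensional ℂ E] [T2Space M] [IsManifold 𝓘(ℂ, E) ω M]
  [IsContMDiffRiemannianBundle 𝓘(ℝ, E) ∞ E (fun x : M => TangentSpace 𝓘(ℝ, E) x)] in
/-- A unitary frame exists at every point of a Hermitian manifold. -/
theorem exists_orthonormal_of_isHermitianMetric [FiniteDimensional ℂ E]
    (hg : IsHermitianMetric E M) (x : M) :
    ∃ u : Fin (Module.finrank ℂ E) → TangentSpace 𝓘(ℝ, E) x,
      (∀ i j, (inner ℝ (u i) (u j) : ℝ) = if i = j then 1 else 0) ∧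
      ∀ i j, (inner ℝ (u i) (tangentJ x (u j)) : ℝ) = 0 :=
  exists_unitary_frame (E := E)
    (fun u v => (inner ℝ (show TangentSpace 𝓘(ℝ, E) x from u) (show TangentSpace 𝓘(ℝ, E) x from v)))
    (fun _ _ => real_inner_comm (F := TangentSpace 𝓘(ℝ, E) x) _ _)
    (fun _ _ _ => inner_add_left (E := TangentSpace 𝓘(ℝ, E) x) _ _ _)
    (fun _ _ _ => real_inner_smul_left (F := TangentSpace 𝓘(ℝ, E) x) _ _ _)
    (fun _ => real_inner_self_nonneg (F := TangentSpace 𝓘(ℝ, E) x))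
    (fun _ h => (inner_self_eq_zero (𝕜 := ℝ) (E := TangentSpace 𝓘(ℝ, E) x)).1 h)
    (fun u v => hg x u v)

/-- If the first Ricci curvature vanishes, then so do the traces of `J R(u, v)`. -/
theorem IsBismutConnection.trace_tangentJ_comp_curvatureHom (hg : IsHermitianMetric E M)
    (hD : IsBismutConnection D) (hRic : FirstRicciVanishes D) (x : M)
    (u v : TangentSpace 𝓘(ℝ, E) x) :
    LinearMap.trace ℝ _ ((tangentJ x).toLinearMap ∘ₗ hD.curvatureHom x u v) = 0 := by
  have : FiniteDimensional ℝ E := FiniteDimensional.complexToReal E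
  have : FiniteDimensional ℝ (TangentSpace 𝓘(ℝ, E) x) := this
  obtain ⟨e, he, he'⟩ := exists_orthonormal_of_isHermitianMetric hg x
  have hJe (i j) : (inner ℝ (tangentJ x (e i)) (e j) : ℝ) = 0 := by
    rw [real_inner_comm, he']
  have hn : Module.finrank ℝ (TangentSpace 𝓘(ℝ, E) x) = 2 * Module.finrank ℂ E :=
    finrank_real_of_complex E
  rw [trace_comp_of_unitary tangentJ_tangentJ (hg x) (hD.curvature_tangentJ x u v) hn he he']
  -- For a unit vector u, the vector u - iJu has Hermitian square length |u|² + |Ju|² = 2, hence the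
  -- factor 1/√2.
  let c : ℝ := (√2)⁻¹
  have hc : c * c = 1 / 2 := by
    simp only [c]
    rw [← mul_inv, Real.mul_self_sqrt (by norm_num)]
    norm_num
  have hframe : IsUnitaryFrame (fun i => toType10 (c • e i)) := by
    refine ⟨fun i => isType10_toType10 _, fun i j => ?_⟩
    simp only [complexMetric, extendC, toType10, conjT, neg_neg, map_smul, inner_neg_left,
      real_inner_smul_left, real_inner_smul_right, he', hJe, hg x (e i) (e j), he]
    split_ifs
    · have h2 : (c : ℂ) * c = 1 / 2 := by
        rw [← Complex.ofReal_mul, hc]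
        norm_num
      push_cast
      linear_combination (2 : ℂ) * h2 - c * c * Complex.I_sq
    · simp
  have h := congrArg Complex.im (hRic x _ hframe (u, 0) (v, 0))
  have h0 (a b : TangentSpace 𝓘(ℝ, E) x) : curvature D x 0 a b = 0 ∧ curvature D x a 0 b = 0 := by
    change hD.curvatureHom x 0 a b = 0 ∧ hD.curvatureHom x a 0 b = 0
    simp
  have hneg (a b d : TangentSpace 𝓘(ℝ, E) x) : curvature D x a b (-d) = -curvature D x a b d :=
    map_neg (hD.curvatureHom x a b) d
  have hterm (i) : (curvatureC D (u, 0) (v, 0) (toType10 (c • e i)) (conjT (toType10 (c • e i)))).im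
      = inner ℝ (curvature D x u v (e i)) (tangentJ x (e i)) := by
    have h1 : (inner ℝ (curvature D x u v (tangentJ x (e i))) (e i) : ℝ)
        = -inner ℝ (curvature D x u v (e i)) (tangentJ x (e i)) := by
      rw [hD.inner_curvature, real_inner_comm]
    simp only [curvatureC, extendC, toType10, conjT, h0, neg_neg, map_smul, hneg,
      hD.curvature_smul_right, inner_neg_left, inner_zero_left, real_inner_smul_left,
      real_inner_smul_right, h1]
    simp
    linear_combination 2 * (inner ℝ (curvature D x u v (e i)) (tangentJ x (e i)) : ℝ) * hc
  rw [firstRicci, Complex.im_sum, Finset.sum_congr rfl fun i _ => hterm i] at h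
  change -2 * ∑ i, (inner ℝ (curvature D x u v (e i)) (tangentJ x (e i)) : ℝ) = 0
  rw [h]
  simp

/-- The Kähler-like identities are used only for vectors x - iJx, and only through their real parts;
these already imply every symmetry that the algebra needs. -/
theorem IsBismutConnection.isFlat (hg : IsHermitianMetric E M) (hD : IsBismutConnection D)
    (hR : ParallelCurvature D) (hKL : IsKahlerLike D) (hRic : FirstRicciVanishes D) :
    IsFlat D := by
  intro x u v w
  have : FiniteDimensional ℝ E := FiniteDimensional.complexToReal E
  have : FiniteDimensional ℝ (TangentSpace 𝓘(ℝ, E) x) := this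
  let J : Module.End ℝ (TangentSpace 𝓘(ℝ, E) x) := (tangentJ x).toLinearMap
  let R := hD.curvatureHom x
  let r (a b c d : TangentSpace 𝓘(ℝ, E) x) : ℝ := inner ℝ (R a b c) d
  have hJ (a) : J (J a) = -a := tangentJ_tangentJ a
  have hJi (a b) : (inner ℝ (J a) (J b) : ℝ) = inner ℝ a b := hg x a b
  have comm (a b c) : R a b (J c) = J (R a b c) := hD.curvature_tangentJ x a b c
  have skew₁ (a b) : R a b = -R b a := LinearMap.ext fun c => curvature_swap x a b c
  have skew₂ (a b c d) : (inner ℝ (R a b c) d : ℝ) = -inner ℝ c (R a b d) :=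
    hD.inner_curvature x a b c d
  have rskew₁ (a b c d) : r a b c d = -r b a c d := by
    simp only [r]
    rw [skew₁, LinearMap.neg_apply, inner_neg_left]
  have rskew₂ (a b c d) : r a b c d = -r a b d c := by
    simp only [r]
    rw [skew₂, real_inner_comm]
  have rinv₂' (a b c d) : r a b (J c) (J d) = r a b c d := by simp only [r, comm, hJi]
  have rinv₂ (a b c d) : r a b (J c) d = -r a b c (J d) := by
    rw [← rinv₂' a b c (J d), hJ]
    simp [r]
  have rsq₁ (a b c d) : r (J (J a)) b c d = -r a b c d := by simp [r, hJ]
  -- Only terms with an even number of imaginary slots are real: i² gives the minus signs and i⁴ the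
  -- last plus.
  have hC (a b c d a' b' c' d' : TangentSpace 𝓘(ℝ, E) x) :
      (curvatureC D (a, a') (b, b') (c, c') (d, d')).re
        = r a b c d - r a' b' c d - r a' b c' d - r a' b c d' - r a b' c' d - r a b' c d'
          - r a b c' d' + r a' b' c' d' := by
    change (extendC (fun u => extendC (fun v => extendC (fun w => extendC (fun z =>
      ((r u v w z : ℝ) : ℂ)) (d, d')) (c, c')) (b, b')) (a, a') : ℂ).re = _
    simp [extendC]
    ring
  have rinv₁ := kahlerLike_invariant (J := J) rskew₂ rinv₂ rinv₂' fun a b c d => by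
    have h := congrArg Complex.re (hKL x (toType10 a) (toType10 b) (toType10 c) (toType10 d)
      (isType10_toType10 a) (isType10_toType10 b) (isType10_toType10 c) (isType10_toType10 d)).1
    simp only [toType10, conjT, neg_neg, hC] at h
    change r a b c d - r (-J a) (-J b) c d - r (-J a) b (-J c) d - r (-J a) b c (J d)
      - r a (-J b) (-J c) d - r a (-J b) c (J d) - r a b (-J c) (J d)
      + r (-J a) (-J b) (-J c) (J d) = 0 at h
    simp only [r, map_neg, LinearMap.neg_apply, inner_neg_left, neg_neg] at h ⊢
    linarith
  have hsymm := kahlerLike_bianchi_and_pair_symm (J := J) rskew₁ rskew₂ rsq₁ rinv₁ rinv₂ rinv₂'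
    fun a b c d => by
      have h := congrArg Complex.re (hKL x (toType10 a) (toType10 b) (toType10 c) (toType10 d)
        (isType10_toType10 a) (isType10_toType10 b) (isType10_toType10 c) (isType10_toType10 d)).2
      simp only [toType10, conjT, neg_neg, hC] at h
      change r a b c d - r (-J a) (J b) c d - r (-J a) b (-J c) d - r (-J a) b c (J d)
        - r a (J b) (-J c) d - r a (J b) c (J d) - r a b (-J c) (J d)
        + r (-J a) (J b) (-J c) (J d)
        = r c b a d - r (-J c) (J b) a d - r (-J c) b (-J a) d - r (-J c) b a (J d)
        - r c (J b) (-J a) d - r c (J b) a (J d) - r c b (-J a) (J d)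
        + r (-J c) (J b) (-J a) (J d) at h
      simp only [r, map_neg, LinearMap.neg_apply, inner_neg_left, neg_neg] at h ⊢
      linarith
  have inv₁ (a b) : R (J a) (J b) = R a b :=
    LinearMap.ext fun c => ext_inner_right ℝ fun d => rinv₁ a b c d
  have bianchi (a b c) : R a b c + R b c a + R c a b = 0 :=
    ext_inner_right ℝ fun d => by
      rw [inner_add_left, inner_add_left, inner_zero_left]
      exact (hsymm a b c d).1
  have ricci := ricci_eq_zero_of_trace_comp hJ skew₁ skew₂ inv₁ comm bianchi
    (fun a b c d => (hsymm a b c d).2) (hD.trace_tangentJ_comp_curvatureHom hg hRic x)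
  exact LinearMap.congr_fun (curvatureTensor_eq_zero skew₁ skew₂ bianchi
    (hD.curvature_curvature hR x) ricci u v) w

end Flat

end HermitianGeometry

theorem proposition1p8 {E : Type*} [NormedAddCommGroup E] [NormedSpace ℂ E] [FiniteDimensional ℂ E]
    {M : Type*} [EMetricSpace M] [ChartedSpace E M] [IsManifold 𝓘(ℂ, E) ω M]
    [RiemannianBundle (fun x : M => TangentSpace 𝓘(ℝ, E) x)]
    [IsContMDiffRiemannianBundle 𝓘(ℝ, E) ∞ E (fun x : M => TangentSpace 𝓘(ℝ, E) x)]
    [IsRiemannianManifold 𝓘(ℝ, E) M] [CompleteSpace M]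
    (hg : HermitianGeometry.IsHermitianMetric E M)
    (D : HermitianGeometry.Connection E M)
    (hD : HermitianGeometry.IsBismutConnection D)
    (hAS : HermitianGeometry.IsAmbroseSinger D)
    (hKL : HermitianGeometry.IsKahlerLike D)
    (hRic : HermitianGeometry.FirstRicciVanishes D) :
    HermitianGeometry.IsFlat D :=
  hD.isFlat hg hAS.2 hKL hRic
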